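/- A closed orientable surface is a compact connected orientable $2$-manifold without boundary; a periodic map is a homeomorphism $f$ of finite order; the $f$-orbit of $x$ is $\{f^k(x):k\in\mathbb Z\}$, and its length is its number of points. Let $p_1<p_2<\dots$ be the prime numbers and $P_l=p_1p_2\cdots p_l$. **Proposition 4.1.** For every integer $l>0$ there are a closed orientable surface $F$ and a periodic map $f$ on $F$, of order $P_l$, such that $F$ contains $l$ points whose $f$-orbit lengths are $p_1,\dots,p_l$ respectively; in particular these $l$ lengths are greater than $1$ and pairwise coprime. Moreover, if $l\ge 2$, then $F$ and $f$ can be chosen so that $F/\langle f\rangle$ is the $2$-sphere with exactly $2l$ cone points, two of order $P_l/p_j$ for each $j=1,\dots,l$. That is, there are a continuous surjection $\pi:F\to S^2$ whose fibres are exactly the $f$-orbits, and $2l$ distinct points $c_j,c'_j\in S^2$ $(1\le j\le l)$, such that: near every $x\in F$ the map $\pi$ has the form $z\mapsto z^{n}$ in suitable local complex coordinates centred at $x$ and $\pi(x)$, where $n$ is the order of the stabilizer of $x$ in $\langle f\rangle$; the points over $c_j$ and over $c'_j$ have stabilizer of order $P_l/p_j$ and $f$-orbit of length $p_j$; and every point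 of $F$ over no $c_j$ or $c'_j$ has trivial stabilizer and $f$-orbit of length $P_l$. -/

import Mathlib

open scoped Manifold ContDiff

/-- A topological space `F` is an orientable surface (without boundary): it is Hausdorff and carries
a smooth two-dimensional atlas all of whose transition maps have positive Jacobian determinant. -/
def IsOrientableSurface (F : Type) [TopologicalSpace F] : Prop :=
  T2Space F ∧
    ∃ _ : ChartedSpace (EuclideanSpace ℝ (Fin 2)) F,
      IsManifold (𝓡 2) ∞ F ∧
        ∀ e ∈ atlas (EuclideanSpace ℝ (Fin 2)) F, ∀ e' ∈ atlas (EuclideanSpace ℝ (Fin 2)) F,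
          ∀ y ∈ (e.symm.trans e').source,
            0 < (fderiv ℝ (fun v => e' (e.symm v)) y).det

/-- A closed orientable surface: a compact, connected (in particular nonempty) orientable surface
without boundary. Second countability follows from compactness. -/
def IsClosedOrientableSurface (F : Type) [TopologicalSpace F] : Prop :=
  IsOrientableSurface F ∧ CompactSpace F ∧ ConnectedSpace F

section PeriodicMap

variable {F : Type} [TopologicalSpace F]

/-- The `f`-orbit `{f ^ k x : k ∈ ℤ}` of the point `x`. -/
def mapOrbit (f : F ≃ₜ F) (x : F) : Set F := {y | ∃ k : ℤ, (f ^ k) x = y}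

/-- The length of the `f`-orbit of `x`, i.e. its number of points. It takes the value `0` on
infinite orbits; these do not occur when `f` is periodic. -/
noncomputable def orbitLength (f : F ≃ₜ F) (x : F) : ℕ := (mapOrbit f x).ncard

/-- The order of the isotropy group of `x` in the cyclic group generated by `f`. -/
noncomputable def isotropyOrder (f : F ≃ₜ F) (x : F) : ℕ :=
  Nat.card {g : F ≃ₜ F // g ∈ Subgroup.zpowers f ∧ g x = x}

/-- In suitable local complex coordinates centred at `x` and `π x`, the map `π` is `z ↦ z ^ n`. -/
def IsPowerMapAt {S : Type} [TopologicalSpace S] (π : F → S) (n : ℕ) (x : F) : Prop :=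
  ∃ (e : OpenPartialHomeomorph F ℂ) (e' : OpenPartialHomeomorph S ℂ),
    x ∈ e.source ∧ e x = 0 ∧ π x ∈ e'.source ∧ e' (π x) = 0 ∧
      ∀ y ∈ e.source, π y ∈ e'.source ∧ e' (π y) = e y ^ n

/-- `π : F → S` is the cyclic branched cover `F → F / f`: a continuous surjection whose fibres are
the `f`-orbits, which near each point `x` is modelled on `z ↦ z ^ n` with `n` the order
of the isotropy group of `x`. For compact `F` and Hausdorff `S` this identifies `S` with
the quotient space `F / f`, and `n` is the order of the orbifold point `π x`. -/
structure IsCyclicBranchedCover {S : Type} [TopologicalSpace S] (f : F ≃ₜ F) (π : F → S) :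
    Prop where
  continuous : Continuous π
  surjective : Function.Surjective π
  fibre : ∀ x y, π x = π y ↔ y ∈ mapOrbit f x
  powerMapAt : ∀ x, IsPowerMapAt π (isotropyOrder f x) x

end PeriodicMap

/-- The product `P_l` of the first `l` primes (`Nat.nth Nat.Prime j` is the prime of index `j`,
counted from `0`). -/
noncomputable def primeProd (l : ℕ) : ℕ := ∏ j : Fin l, Nat.nth Nat.Prime j

/-!
Write `B` for the Riemann sphere `OnePoint ℂ`, and fix `2 * l` distinct points `c (j, s)` of `ℂ`.
The surface is the fibre product over `B` of the curves `w i ^ p i = g i z` (`RootSpace`), where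
`g i` is a continuous function with simple zeros, as a map of real surfaces, exactly at the points
`c (j, s)` with `j ≠ i`, and the map `f` multiplies each `w i` by a primitive `p i`-th root of unity
(`RootSpace.rotation`). By the Chinese remainder theorem the `f`-orbits are the fibres over `B`, and
the isotropy over `z` is the product of the cyclic groups of those `p i` with `g i z = 0`: nothing
off the points `c (j, s)`, and all primes but `p j` at `c (j, s)`.

The total degree of the zeros of `g i` is zero, as a function on the sphere requires: `g i` is a
product of functions `(z - a) * conj (z - b) / (1 + |z| ^ 2)` (`RiemannSphere.dipole`), holomorphic
up to a unit near `a` and antiholomorphic up to a unit near `b`. This replaces meromorphic functions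
with zeros `a` and poles `b`, and keeps the roots `w i` finite.

In a coordinate `φ` in which the ramified `g i` are `φ` times a unit, the `w i` are, up to units,
roots of `φ` of pairwise coprime exponents, so they are powers of one root `t` of exponent
`m = ∏ p i`, a monomial in them by Bézout. Hence `t` is a chart, although the fibre product is not
smooth in its ambient space, and in it the projection is `t ↦ t ^ m` (`RootSpace.exists_chart`).
At a zero of antiholomorphic type the conjugate of `t` is used.

Every such chart `e` satisfies `φ ∘ π = e ^ m` with a holomorphic coordinate `φ` of `B`, so a
coordinate change is a continuous injective root of a holomorphic function. It is holomorphic off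
its only possible zero, which is a removable singularity. The atlas is therefore smooth and oriented
(`isOrientableSurface_of_powerChart`). The surface is connected because each component maps onto `B`
and so contains points fixed by `f ^ p i` and by `f ^ p j` for two coprime `p i`, `p j`
(`preconnectedSpace_of_orbit_fibres`). For `l = 1` this argument fails, and the surface for two
primes serves, with the cube of its map of order `6`.
-/

open Set Filter Topology

/-! ### Orientability of spaces with power-map charts -/

/-- A continuous `n`-th root of a holomorphic function is holomorphic off its zeros. -/
theorem differentiableAt_of_pow_differentiableAt {f : ℂ → ℂ} {n : ℕ} {y : ℂ}
    (hn : n ≠ 0) (hf : ContinuousAt f y) (h0 : f y ≠ 0)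
    (hd : DifferentiableAt ℂ (fun z => f z ^ n) y) : DifferentiableAt ℂ f y := by
  have hs : HasStrictDerivAt (fun z : ℂ => z ^ n) ((n : ℂ) * f y ^ (n - 1)) (f y) :=
    hasStrictDerivAt_pow n (f y)
  have hne : (n : ℂ) * f y ^ (n - 1) ≠ 0 :=
    mul_ne_zero (Nat.cast_ne_zero.2 hn) (pow_ne_zero _ h0)
  have hr : DifferentiableAt ℂ (hs.localInverse _ _ _ hne) (f y ^ n) :=
    (hs.to_localInverse hne).hasDerivAt.differentiableAt
  have hleft : ∀ᶠ z in 𝓝 y, hs.localInverse _ _ _ hne (f z ^ n) = f z :=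
    hf.eventually (hs.hasStrictFDerivAt_equiv hne).eventually_left_inverse
  refine (DifferentiableAt.comp y hr hd).congr_of_eventuallyEq ?_
  filter_upwards [hleft] with z hz using hz.symm

/-- A continuous injective `n`-th root of a holomorphic function is holomorphic: its only possible
zero is a removable singularity. -/
theorem differentiableOn_of_injOn_of_pow {f : ℂ → ℂ} {U : Set ℂ} {n : ℕ} (hU : IsOpen U)
    (hn : n ≠ 0) (hf : ContinuousOn f U) (hinj : InjOn f U)
    (hd : DifferentiableOn ℂ (fun z => f z ^ n) U) : DifferentiableOn ℂ f U := by
  have key : ∀ z ∈ U, f z ≠ 0 → DifferentiableAt ℂ f z := fun z hz h0 =>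
    differentiableAt_of_pow_differentiableAt hn (hf.continuousAt (hU.mem_nhds hz)) h0
      (hd.differentiableAt (hU.mem_nhds hz))
  by_cases h : ∃ y ∈ U, f y = 0
  · obtain ⟨y, hy, hy0⟩ := h
    refine (Complex.differentiableOn_compl_singleton_and_continuousAt_iff (hU.mem_nhds hy)).1
      ⟨fun z hz => (key z hz.1 fun h0 => hz.2 ?_).differentiableWithinAt,
        hf.continuousAt (hU.mem_nhds hy)⟩
    exact hinj hz.1 hy (h0.trans hy0.symm)
  · push Not at h
    exact fun z hz => (key z hz (h z hz)).differentiableWithinAt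

/-- The real Jacobian determinant of a complex-linear map of `ℂ` is positive unless the map
vanishes. -/
theorem det_restrictScalars_toSpanSingleton_pos {c : ℂ} (hc : c ≠ 0) :
    0 < (ContinuousLinearMap.restrictScalars ℝ
      (ContinuousLinearMap.toSpanSingleton ℂ c)).det := by
  have : (ContinuousLinearMap.restrictScalars ℝ (ContinuousLinearMap.toSpanSingleton ℂ c)).det
      = Complex.normSq c := by
    rw [ContinuousLinearMap.det, ← LinearMap.det_toMatrix Complex.basisOneI,
      Matrix.det_fin_two]
    simp [LinearMap.toMatrix_apply, Complex.normSq_apply]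
  rw [this]
  exact Complex.normSq_pos.2 hc

/-- The chart `e` of `F` is a power-map chart over the family `A` of charts of `B`: in `e` and some
chart of the family, `π` is `z ↦ z ^ n`. -/
def IsPowerChart {F B : Type} [TopologicalSpace F] [TopologicalSpace B] (π : F → B)
    (A : Set (OpenPartialHomeomorph B ℂ)) (e : OpenPartialHomeomorph F ℂ) : Prop :=
  ∃ φ ∈ A, ∃ n : ℕ, n ≠ 0 ∧ ∀ y ∈ e.source, π y ∈ φ.source ∧ φ (π y) = e y ^ n

/-- Coordinate changes between power-map charts over a holomorphic atlas are holomorphic. -/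
theorem IsPowerChart.differentiableOn {F B : Type} [TopologicalSpace F] [TopologicalSpace B]
    {π : F → B} {A : Set (OpenPartialHomeomorph B ℂ)}
    (hA : ∀ φ ∈ A, ∀ ψ ∈ A, DifferentiableOn ℂ (ψ ∘ φ.symm) (φ.symm.trans ψ).source)
    {e e' : OpenPartialHomeomorph F ℂ} (he : IsPowerChart π A e) (he' : IsPowerChart π A e') :
    DifferentiableOn ℂ (e.symm.trans e') (e.symm.trans e').source := by
  obtain ⟨φ, hφ, n, hn, h⟩ := he
  obtain ⟨ψ, hψ, m, hm, h'⟩ := he'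
  refine differentiableOn_of_injOn_of_pow (e.symm.trans e').open_source hm
    (e.symm.trans e').continuousOn (e.symm.trans e').injOn ?_
  have hmaps : MapsTo (fun z : ℂ => z ^ n) (e.symm.trans e').source (φ.symm.trans ψ).source := by
    intro z hz
    simp only [OpenPartialHomeomorph.trans_source, OpenPartialHomeomorph.symm_source,
      mem_inter_iff, mem_preimage] at hz ⊢
    have h1 := h _ (e.map_target hz.1)
    rw [e.right_inv hz.1] at h1
    rw [← h1.2]
    exact ⟨φ.map_source h1.1, by rw [φ.left_inv h1.1]; exact (h' _ hz.2).1⟩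
  refine ((hA φ hφ ψ hψ).comp ((differentiable_id.pow n).differentiableOn) hmaps).congr ?_
  intro z hz
  simp only [OpenPartialHomeomorph.trans_source, OpenPartialHomeomorph.symm_source,
      mem_inter_iff, mem_preimage] at hz
  have h1 := h _ (e.map_target hz.1)
  rw [e.right_inv hz.1] at h1
  simp only [Function.comp_apply, OpenPartialHomeomorph.coe_trans]
  rw [← (h' _ hz.2).2]
  simp only [Pi.pow_apply]
  rw [← h1.2, φ.left_inv h1.1]

/-- The coordinate isometry `ℂ ≃ ℝ²`. -/
noncomputable def complexCoord : ℂ ≃ₗᵢ[ℝ] EuclideanSpace ℝ (Fin 2) :=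
  Complex.orthonormalBasisOneI.repr

/-- The real coordinate change obtained from a biholomorphic one preserves orientation. -/
theorem det_fderiv_complexCoord_pos {T : OpenPartialHomeomorph ℂ ℂ}
    (hT : DifferentiableOn ℂ T T.source) (hT' : DifferentiableOn ℂ T.symm T.target)
    {z : ℂ} (hz : z ∈ T.source) :
    0 < (fderiv ℝ (fun v => complexCoord (T (complexCoord.symm v))) (complexCoord z)).det := by
  have h1 : HasDerivAt T (deriv T z) z :=
    (hT.differentiableAt (T.open_source.mem_nhds hz)).hasDerivAt
  have h2 : HasDerivAt T.symm (deriv T.symm (T z)) (T z) :=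
    (hT'.differentiableAt (T.open_target.mem_nhds (T.map_source hz))).hasDerivAt
  have hne : deriv T z ≠ 0 := by
    intro h0
    have h3 : HasDerivAt (T.symm ∘ T) (deriv T.symm (T z) * deriv T z) z := h2.comp z h1
    have h4 : HasDerivAt (T.symm ∘ T) 1 z := by
      refine (hasDerivAt_id z).congr_of_eventuallyEq ?_
      filter_upwards [T.open_source.mem_nhds hz] with w hw using T.left_inv hw
    have := h3.unique h4
    simp [h0] at this
  have h5 := h1.hasFDerivAt.restrictScalars ℝ
  have hz' : complexCoord.symm (complexCoord z) = z := by simp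
  rw [← hz'] at h5
  have h6 := (complexCoord.toContinuousLinearEquiv.hasFDerivAt).comp (complexCoord z)
    (h5.comp (complexCoord z) (complexCoord.symm.toContinuousLinearEquiv.hasFDerivAt))
  have h7 : fderiv ℝ (fun v => complexCoord (T (complexCoord.symm v))) (complexCoord z) = _ :=
    h6.fderiv
  rw [h7, hz']
  have := det_restrictScalars_toSpanSingleton_pos hne
  rw [ContinuousLinearMap.det] at this ⊢
  have h8 := LinearMap.det_conj (ContinuousLinearMap.restrictScalars ℝ
      (ContinuousLinearMap.toSpanSingleton ℂ (deriv T z))).toLinearMap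
      complexCoord.toLinearEquiv
  rw [← h8] at this
  exact this

/-- A Hausdorff space with power-map charts over a holomorphic atlas is an orientable surface. -/
theorem isOrientableSurface_of_powerChart {F B : Type} [TopologicalSpace F] [T2Space F]
    [TopologicalSpace B]
    {π : F → B} {A : Set (OpenPartialHomeomorph B ℂ)}
    (hA : ∀ φ ∈ A, ∀ ψ ∈ A, DifferentiableOn ℂ (ψ ∘ φ.symm) (φ.symm.trans ψ).source)
    (hc : ∀ x : F, ∃ e, IsPowerChart π A e ∧ x ∈ e.source) : IsOrientableSurface F := by
  refine ⟨inferInstance, ?_⟩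
  choose e he hx using hc
  let C := complexCoord.toHomeomorph
  let cs : ChartedSpace (EuclideanSpace ℝ (Fin 2)) F :=
    { atlas := {E | ∃ e, IsPowerChart π A e ∧ E = e.transHomeomorph C}
      chartAt := fun x => (e x).transHomeomorph C
      mem_chart_source := fun x => by simpa using hx x
      chart_mem_atlas := fun x => ⟨e x, he x, rfl⟩ }
  refine ⟨cs, ?_, ?_⟩
  · refine isManifold_of_contDiffOn _ _ _ ?_
    rintro _ _ ⟨e₁, h₁, rfl⟩ ⟨e₂, h₂, rfl⟩
    have hd : ContDiffOn ℝ ∞ (e₁.symm.trans e₂) (e₁.symm.trans e₂).source :=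
      ((h₁.differentiableOn hA h₂).contDiffOn (e₁.symm.trans e₂).open_source).restrict_scalars ℝ
    have h3 := complexCoord.contDiff (n := ∞) |>.comp_contDiffOn
      (hd.comp complexCoord.symm.contDiff.contDiffOn (mapsTo_preimage _ _))
    refine (h3.congr ?_).mono ?_
    · intro y hy
      rfl
    · intro y hy
      simpa [C] using hy.1
  · rintro _ ⟨e₁, h₁, rfl⟩ _ ⟨e₂, h₂, rfl⟩ y hy
    have hy' : complexCoord.symm y ∈ (e₁.symm.trans e₂).source := by simpa [C] using hy
    have := det_fderiv_complexCoord_pos (h₁.differentiableOn hA h₂)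
      (h₂.differentiableOn hA h₁) hy'
    rw [LinearIsometryEquiv.apply_symm_apply] at this
    exact this

/-! ### Orbits of a cyclic group of homeomorphisms -/

section Orbits

variable {F : Type} [TopologicalSpace F] {f : F ≃ₜ F} {x : F} {L : ℕ}

theorem zpow_apply_eq_iff_of_period (h : ∀ k : ℤ, (f ^ k) x = x ↔ (L : ℤ) ∣ k) (a b : ℤ) :
    (f ^ a) x = (f ^ b) x ↔ (L : ℤ) ∣ a - b := by
  rw [← h, sub_eq_neg_add, zpow_add, Homeomorph.mul_apply, zpow_neg, Homeomorph.inv_apply,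
    Homeomorph.symm_apply_eq]

theorem orbitLength_eq_of_period (hL : L ≠ 0) (h : ∀ k : ℤ, (f ^ k) x = x ↔ (L : ℤ) ∣ k) :
    orbitLength f x = L := by
  have hO : mapOrbit f x = (fun k : ℕ => (f ^ (k : ℤ)) x) '' (Finset.range L : Set ℕ) := by
    ext y
    constructor
    · rintro ⟨k, rfl⟩
      have h0 : (0 : ℤ) ≤ k % L := Int.emod_nonneg _ (by exact_mod_cast hL)
      have h1 : k % L < L := Int.emod_lt_of_pos _ (by exact_mod_cast Nat.pos_of_ne_zero hL)
      refine ⟨(k % L).toNat, by simp; omega, ?_⟩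
      simp only [Int.toNat_of_nonneg h0]
      rw [zpow_apply_eq_iff_of_period h]
      exact (Int.mod_modEq k L).symm.dvd
    · rintro ⟨k, -, rfl⟩
      exact ⟨k, rfl⟩
  rw [orbitLength, hO, Set.InjOn.ncard_image, Set.ncard_coe_finset, Finset.card_range]
  intro a ha b hb hab
  rw [zpow_apply_eq_iff_of_period h] at hab
  simp only [Finset.coe_range, mem_Iio] at ha hb
  have := Int.eq_zero_of_abs_lt_dvd hab (by rw [abs_lt]; omega)
  omega

theorem isotropyOrder_eq_of_period (hf : orderOf f ≠ 0)
    (h : ∀ k : ℤ, (f ^ k) x = x ↔ (L : ℤ) ∣ k) : isotropyOrder f x = orderOf f / L := by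
  have hL : L ∣ orderOf f := by
    have := (h (orderOf f)).1 (by simp [pow_orderOf_eq_one])
    exact_mod_cast this
  have hset : ∀ g : F ≃ₜ F, (g ∈ Subgroup.zpowers f ∧ g x = x) ↔ g ∈ Subgroup.zpowers (f ^ L) := by
    intro g
    constructor
    · rintro ⟨⟨k, rfl⟩, hk⟩
      obtain ⟨m, rfl⟩ := (h k).1 hk
      exact ⟨m, by simp [zpow_mul]⟩
    · rintro ⟨m, rfl⟩
      have : (f ^ L) ^ m = f ^ ((L : ℤ) * m) := by simp [zpow_mul]
      simp only [this]
      exact ⟨⟨_, rfl⟩, (h _).2 (dvd_mul_right _ _)⟩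
  rw [isotropyOrder, Nat.card_congr (Equiv.subtypeEquivRight hset)]
  change Nat.card (Subgroup.zpowers (f ^ L)) = _
  rw [Nat.card_zpowers, orderOf_pow' , Nat.gcd_eq_right hL]
  rintro rfl
  exact hf (Nat.eq_zero_of_zero_dvd hL)

end Orbits

/-! ### The fibre product of root extractions -/

section RootSpace

variable {B : Type} {ι : Type} {p : ι → ℕ} {g : ι → B → ℂ}

/-- The space of pairs `(z, w)` with `z ∈ B` and `w i` a `p i`-th root of `g i z` for each `i`: the
fibre product over `B` of the branched covers `w ^ p i = g i z`. -/
abbrev RootSpace (p : ι → ℕ) (g : ι → B → ℂ) : Type :=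
  {y : B × (ι → ℂ) // ∀ i, y.2 i ^ p i = g i y.1}

namespace RootSpace

/-- The projection to the base. -/
abbrev proj (y : RootSpace p g) : B := y.1.1

theorem coord_eq_zero_iff (hp : ∀ i, p i ≠ 0) (y : RootSpace p g) (i : ι) :
    y.1.2 i = 0 ↔ g i y.proj = 0 := by
  rw [← y.2 i, pow_eq_zero_iff (hp i)]

theorem surjective_proj (hp : ∀ i, p i ≠ 0) : Function.Surjective (proj : RootSpace p g → B) := by
  intro b
  choose w hw using fun i => IsAlgClosed.exists_pow_nat_eq (g i b) (Nat.pos_of_ne_zero (hp i))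
  exact ⟨⟨(b, w), hw⟩, rfl⟩

/-- The product of those `p i` for which the `i`-th root is unramified over `b`. It is the length of the
orbits over `b`. -/
noncomputable def fibreCard [Fintype ι] (p : ι → ℕ) (g : ι → B → ℂ) (b : B) : ℕ :=
  open Classical in ∏ i with g i b ≠ 0, p i

/-- The product of those `p i` for which the `i`-th root is ramified over `b`. -/
noncomputable def ramification [Fintype ι] (p : ι → ℕ) (g : ι → B → ℂ) (b : B) : ℕ :=
  open Classical in ∏ i with g i b = 0, p i

theorem ramification_mul_fibreCard [Fintype ι] (b : B) :
    ramification p g b * fibreCard p g b = ∏ i, p i := by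
  classical
  rw [ramification, fibreCard]
  exact Finset.prod_filter_mul_prod_filter_not _ _ _

theorem fibreCard_ne_zero [Fintype ι] (hp : ∀ i, p i ≠ 0) (b : B) : fibreCard p g b ≠ 0 :=
  Finset.prod_ne_zero_iff.2 fun i _ => hp i

variable [TopologicalSpace B]

theorem continuous_proj : Continuous (proj : RootSpace p g → B) :=
  continuous_fst.comp continuous_subtype_val

theorem continuous_coord (i : ι) : Continuous fun y : RootSpace p g => y.1.2 i :=
  (continuous_apply i).comp (continuous_snd.comp continuous_subtype_val)

theorem compactSpace [CompactSpace B] (hp : ∀ i, p i ≠ 0) (hg : ∀ i, Continuous (g i)) :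
    CompactSpace (RootSpace p g) := by
  have hb : ∀ i, ∃ C, ∀ b, ‖g i b‖ ≤ C := fun i => by
    obtain ⟨C, hC⟩ := (isCompact_range (hg i)).isBounded.exists_norm_le
    exact ⟨C, fun b => hC _ (mem_range_self b)⟩
  choose C hC using hb
  have hK : IsCompact ((univ : Set B) ×ˢ
      (Set.pi univ fun i => Metric.closedBall (0 : ℂ) (max 1 (C i)))) :=
    isCompact_univ.prod (isCompact_univ_pi fun i => isCompact_closedBall _ _)
  have hcl : IsClosed {y : B × (ι → ℂ) | ∀ i, y.2 i ^ p i = g i y.1} := by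
    simp only [ofPred_forall]
    exact isClosed_iInter fun i => isClosed_eq
      (((continuous_apply i).comp continuous_snd).pow _) ((hg i).comp continuous_fst)
  refine isCompact_iff_compactSpace.1 (hK.of_isClosed_subset hcl ?_)
  rintro ⟨b, w⟩ hy
  refine ⟨mem_univ _, fun i _ => ?_⟩
  rw [mem_closedBall_zero_iff]
  by_contra! hlt
  have h1 : 1 ≤ ‖w i‖ := (le_max_left _ _).trans hlt.le
  have h2 : ‖w i‖ ≤ C i := by
    calc ‖w i‖ ≤ ‖w i‖ ^ p i := le_self_pow₀ h1 (hp i)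
      _ = ‖g i b‖ := by rw [← norm_pow]; exact congrArg norm (hy i)
      _ ≤ C i := hC i b
  exact absurd (h2.trans (le_max_right _ _)) (not_le.2 hlt)

/-- The standard primitive `n`-th root of unity. -/
noncomputable def zeta (n : ℕ) : ℂ := Complex.exp (2 * Real.pi * Complex.I / n)

theorem zeta_ne_zero (n : ℕ) : zeta n ≠ 0 := Complex.exp_ne_zero _

theorem zeta_pow (n : ℕ) : zeta n ^ n = 1 := by
  rcases eq_or_ne n 0 with rfl | hn
  · simp
  · exact (Complex.isPrimitiveRoot_exp n hn).pow_eq_one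

/-- The deck transformation multiplying the `i`-th coordinate by the standard primitive `p i`-th
root of unity. -/
noncomputable def rotation (p : ι → ℕ) (g : ι → B → ℂ) : RootSpace p g ≃ₜ RootSpace p g where
  toFun y := ⟨(y.1.1, fun i => zeta (p i) * y.1.2 i), fun i => by
    simp only [mul_pow, zeta_pow, one_mul, y.2 i]⟩
  invFun y := ⟨(y.1.1, fun i => (zeta (p i))⁻¹ * y.1.2 i), fun i => by
    simp only [mul_pow, inv_pow, zeta_pow, inv_one, one_mul, y.2 i]⟩
  left_inv y := by
    ext i
    · rfl
    · simp [inv_mul_cancel_left₀ (zeta_ne_zero _)]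
  right_inv y := by
    ext i
    · rfl
    · simp [mul_inv_cancel_left₀ (zeta_ne_zero _)]
  continuous_toFun := by fun_prop
  continuous_invFun := by fun_prop

theorem rotation_zpow_apply (k : ℤ) (y : RootSpace p g) :
    ((rotation p g ^ k) y).1 = (y.1.1, fun i => zeta (p i) ^ k * y.1.2 i) := by
  induction k using Int.induction_on generalizing y with
  | zero => simp
  | succ n ih =>
    rw [zpow_add_one, Homeomorph.mul_apply, ih]
    ext i
    · rfl
    · simp only [zpow_add_one₀ (zeta_ne_zero _), mul_assoc]
      rfl
  | pred n ih =>
    rw [zpow_sub_one, Homeomorph.mul_apply, ih]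
    ext i
    · rfl
    · simp only [zpow_sub_one₀ (zeta_ne_zero _), mul_assoc]
      rfl

theorem isPrimitiveRoot_zeta {n : ℕ} (hn : n ≠ 0) : IsPrimitiveRoot (zeta n) n :=
  Complex.isPrimitiveRoot_exp n hn

variable [Fintype ι]

theorem rotation_zpow_apply_eq_self_iff (hp : ∀ i, p i ≠ 0)
    (hcop : Pairwise fun i j => (p i).Coprime (p j)) (y : RootSpace p g) (k : ℤ) :
    (rotation p g ^ k) y = y ↔ (fibreCard p g y.proj : ℤ) ∣ k := by
  classical
  have h1 : (rotation p g ^ k) y = y ↔ ∀ i, g i y.proj ≠ 0 → (p i : ℤ) ∣ k := by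
    rw [Subtype.ext_iff, rotation_zpow_apply, Prod.ext_iff]
    simp only [true_and, funext_iff]
    refine forall_congr' fun i => ?_
    rw [mul_left_eq_self₀, ← (isPrimitiveRoot_zeta (hp i)).zpow_eq_one_iff_dvd]
    have := coord_eq_zero_iff hp y i
    tauto
  rw [h1, fibreCard]
  push_cast
  constructor
  · intro h
    refine Finset.prod_dvd_of_coprime (fun i _ j _ hij => (hcop hij).isCoprime) fun i hi => ?_
    exact h i (Finset.mem_filter.1 hi).2
  · intro h i hi
    exact (Finset.dvd_prod_of_mem (fun i => (p i : ℤ)) (by simp [hi])).trans h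

theorem proj_eq_iff_mem_mapOrbit (hp : ∀ i, p i ≠ 0)
    (hcop : Pairwise fun i j => (p i).Coprime (p j)) (x y : RootSpace p g) :
    x.proj = y.proj ↔ y ∈ mapOrbit (rotation p g) x := by
  constructor
  · intro hxy
    have h1 : ∀ i, ∃ k : ℕ, zeta (p i) ^ k * x.1.2 i = y.1.2 i := by
      intro i
      have hy := y.2 i
      change y.1.2 i ^ p i = g i y.proj at hy
      rw [← hxy] at hy
      by_cases h0 : x.1.2 i = 0
      · refine ⟨0, ?_⟩
        rw [(coord_eq_zero_iff hp x i).1 h0, pow_eq_zero_iff (hp i)] at hy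
        simp [h0, hy]
      · have : NeZero (p i) := ⟨hp i⟩
        obtain ⟨k, -, hk⟩ := (isPrimitiveRoot_zeta (hp i)).eq_pow_of_pow_eq_one
          (ξ := y.1.2 i / x.1.2 i) (by
            rw [div_pow, hy, x.2 i, div_self]
            rw [← x.2 i]
            exact pow_ne_zero _ h0)
        exact ⟨k, by rw [hk, div_mul_cancel₀ _ h0]⟩
    choose k hk using h1
    obtain ⟨m, hm⟩ := Nat.chineseRemainderOfFinset k p Finset.univ (fun i _ => hp i)
      (fun i _ j _ hij => hcop hij)
    refine ⟨m, Subtype.ext ?_⟩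
    rw [rotation_zpow_apply]
    ext i
    · exact hxy
    · simp only [zpow_natCast]
      rw [← hk i, pow_eq_pow_mod m (zeta_pow (p i)), hm i (Finset.mem_univ i),
        ← pow_eq_pow_mod (k i) (zeta_pow (p i))]
  · rintro ⟨k, rfl⟩
    exact (congrArg Prod.fst (rotation_zpow_apply k x)).symm

theorem orderOf_rotation (hp : ∀ i, p i ≠ 0)
    (hcop : Pairwise fun i j => (p i).Coprime (p j)) {b : B} (hb : ∀ i, g i b ≠ 0) :
    orderOf (rotation p g) = ∏ i, p i := by
  classical
  refine Nat.dvd_antisymm (orderOf_dvd_of_pow_eq_one ?_) ?_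
  · ext1 y
    rw [← zpow_natCast]
    refine (rotation_zpow_apply_eq_self_iff hp hcop y _).2 ?_
    rw [← ramification_mul_fibreCard (p := p) (g := g) y.proj]
    exact_mod_cast dvd_mul_left _ _
  · obtain ⟨y, rfl⟩ := surjective_proj (g := g) hp b
    have := (rotation_zpow_apply_eq_self_iff hp hcop y (orderOf (rotation p g))).1
      (by simp [pow_orderOf_eq_one])
    have h2 : fibreCard p g y.proj = ∏ i, p i := by
      rw [fibreCard, Finset.filter_true_of_mem fun i _ => hb i]
    rw [h2] at this
    exact_mod_cast this

theorem orbitLength_rotation (hp : ∀ i, p i ≠ 0)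
    (hcop : Pairwise fun i j => (p i).Coprime (p j)) (y : RootSpace p g) :
    orbitLength (rotation p g) y = fibreCard p g y.proj :=
  orbitLength_eq_of_period (fibreCard_ne_zero hp _) (rotation_zpow_apply_eq_self_iff hp hcop y)

theorem isotropyOrder_rotation (hp : ∀ i, p i ≠ 0)
    (hcop : Pairwise fun i j => (p i).Coprime (p j)) {b : B} (hb : ∀ i, g i b ≠ 0)
    (y : RootSpace p g) :
    isotropyOrder (rotation p g) y = ramification p g y.proj := by
  have hord := orderOf_rotation hp hcop hb
  rw [isotropyOrder_eq_of_period (by rw [hord]; exact Finset.prod_ne_zero_iff.2 fun i _ => hp i)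
    (rotation_zpow_apply_eq_self_iff hp hcop y), hord,
    ← ramification_mul_fibreCard (p := p) (g := g) y.proj,
    Nat.mul_div_cancel _ (Nat.pos_of_ne_zero (fibreCard_ne_zero hp _))]

end RootSpace

end RootSpace

/-! ### Simultaneous roots of coprime exponents -/

/-- Roots `u i` of `a` of pairwise coprime exponents `p i` are powers of one root of `a` of
exponent `∏ p i`. -/
theorem exists_common_root {G ι : Type} [CommGroup G] [DecidableEq ι] {p : ι → ℕ}
    (hcop : Pairwise fun i j => (p i).Coprime (p j)) (a : G) (u : ι → G) (I : Finset ι)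
    (hu : ∀ i ∈ I, u i ^ p i = a) :
    ∃ t : G, t ^ (∏ i ∈ I, p i) = a ∧ ∀ i ∈ I, t ^ (∏ j ∈ I.erase i, p j) = u i := by
  induction I using Finset.induction_on with
  | empty => exact ⟨a, by simp, by simp⟩
  | insert i₀ I hi₀ ih =>
    obtain ⟨t, ht, hti⟩ := ih fun i hi => hu i (Finset.mem_insert_of_mem hi)
    set M := ∏ i ∈ I, p i with hM
    have hc : (p i₀).Coprime M := Nat.Coprime.prod_right fun i hi =>
      hcop (by rintro rfl; exact hi₀ hi)
    obtain ⟨α, β, hαβ⟩ : IsCoprime (M : ℤ) (p i₀ : ℤ) := hc.symm.isCoprime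
    have hu₀ := hu i₀ (Finset.mem_insert_self _ _)
    have h1 : (u i₀ ^ α * t ^ β) ^ p i₀ = t := by
      calc (u i₀ ^ α * t ^ β) ^ p i₀ = (u i₀ ^ p i₀) ^ α * t ^ (β * p i₀) := by
            rw [mul_pow, ← zpow_natCast, ← zpow_natCast, ← zpow_natCast, ← zpow_mul, ← zpow_mul,
              ← zpow_mul, mul_comm α]
        _ = t ^ (α * M + β * p i₀) := by
            rw [hu₀, ← ht, zpow_add, ← zpow_natCast, ← zpow_mul, mul_comm α]
        _ = t := by rw [hαβ, zpow_one]
    have h2 : (u i₀ ^ α * t ^ β) ^ M = u i₀ := by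
      calc (u i₀ ^ α * t ^ β) ^ M = u i₀ ^ (α * M) * (t ^ M) ^ β := by
            rw [mul_pow, ← zpow_natCast, ← zpow_natCast, ← zpow_natCast, ← zpow_mul, ← zpow_mul,
              ← zpow_mul, mul_comm β]
        _ = u i₀ ^ (α * M + β * p i₀) := by
            rw [ht, ← hu₀, zpow_add, ← zpow_natCast, ← zpow_mul, mul_comm β]
        _ = u i₀ := by rw [hαβ, zpow_one]
    refine ⟨u i₀ ^ α * t ^ β, ?_, fun i hi => ?_⟩
    · rw [Finset.prod_insert hi₀, pow_mul, h1, ht]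
    · rcases Finset.mem_insert.1 hi with rfl | hi
      · rw [Finset.erase_insert hi₀, h2]
      · have hne : i₀ ≠ i := by rintro rfl; exact hi₀ hi
        rw [Finset.erase_insert_of_ne hne, Finset.prod_insert (by simp [hi₀]), pow_mul, h1,
          hti i hi]

theorem exists_bezout_prod_erase {ι : Type} [DecidableEq ι] {p : ι → ℕ}
    (hcop : Pairwise fun i j => (p i).Coprime (p j)) (I : Finset ι) :
    ∃ (α : ℤ) (β : ι → ℤ),
      α * ((∏ i ∈ I, p i : ℕ) : ℤ) + ∑ i ∈ I, β i * ((∏ j ∈ I.erase i, p j : ℕ) : ℤ) = 1 := by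
  rcases I.eq_empty_or_nonempty with rfl | hI
  · exact ⟨1, 0, by simp⟩
  · obtain ⟨β, hβ⟩ := (exists_sum_eq_one_iff_pairwise_coprime (s := fun i => (p i : ℤ)) hI).2
      fun i j hij => (hcop fun h => hij (Subtype.ext h)).isCoprime
    refine ⟨0, β, ?_⟩
    rw [zero_mul, zero_add, ← hβ]
    refine Finset.sum_congr rfl fun i _ => ?_
    rw [Finset.erase_eq]
    push_cast
    rfl

/-- The monomial `a ^ α * ∏ u i ^ β i`, extended by `0` to `a = 0`. With Bézout exponents it
recovers `t` from the powers of `t` occurring in `exists_common_root`. -/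
noncomputable def rootMonomial {ι : Type} (I : Finset ι) (α : ℤ) (β : ι → ℤ) (a : ℂ) (u : ι → ℂ) :
    ℂ :=
  open Classical in if a = 0 then 0 else a ^ α * ∏ i ∈ I, u i ^ β i

section Monomial

variable {ι : Type} [DecidableEq ι] {p : ι → ℕ} {I : Finset ι} {α : ℤ} {β : ι → ℤ}

theorem rootMonomial_pow (hp : ∀ i, p i ≠ 0)
    (hb : α * ((∏ i ∈ I, p i : ℕ) : ℤ) + ∑ i ∈ I, β i * ((∏ j ∈ I.erase i, p j : ℕ) : ℤ) = 1)
    {u : ι → ℂ} {t : ℂ} (hu : ∀ i ∈ I, u i = t ^ (∏ j ∈ I.erase i, p j)) :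
    rootMonomial I α β (t ^ (∏ i ∈ I, p i)) u = t := by
  have hM : (∏ i ∈ I, p i) ≠ 0 := Finset.prod_ne_zero_iff.2 fun i _ => hp i
  by_cases h : t = 0
  · rw [rootMonomial, if_pos (by rw [h, zero_pow hM]), h]
  · rw [rootMonomial, if_neg (pow_ne_zero _ h)]
    have h1 : ∀ J : Finset ι, ∀ n : ι → ℤ, ∏ i ∈ J, t ^ n i = t ^ ∑ i ∈ J, n i := by
      intro J n
      induction J using Finset.induction_on with
      | empty => simp
      | insert i J hi ih => rw [Finset.prod_insert hi, Finset.sum_insert hi, zpow_add₀ h, ih]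
    calc (t ^ (∏ i ∈ I, p i)) ^ α * ∏ i ∈ I, u i ^ β i
        = t ^ (α * ((∏ i ∈ I, p i : ℕ) : ℤ)) *
          ∏ i ∈ I, t ^ (β i * ((∏ j ∈ I.erase i, p j : ℕ) : ℤ)) := by
          congr 1
          · rw [← zpow_natCast, ← zpow_mul, mul_comm]
          · refine Finset.prod_congr rfl fun i hi => ?_
            rw [hu i hi, ← zpow_natCast, ← zpow_mul, mul_comm]
      _ = t := by rw [h1, ← zpow_add₀ h, hb, zpow_one]

theorem rootMonomial_spec (hp : ∀ i, p i ≠ 0) (hcop : Pairwise fun i j => (p i).Coprime (p j))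
    (hb : α * ((∏ i ∈ I, p i : ℕ) : ℤ) + ∑ i ∈ I, β i * ((∏ j ∈ I.erase i, p j : ℕ) : ℤ) = 1)
    {a : ℂ} {u : ι → ℂ} (hu : ∀ i ∈ I, u i ^ p i = a) :
    rootMonomial I α β a u ^ (∏ i ∈ I, p i) = a ∧
      ∀ i ∈ I, rootMonomial I α β a u ^ (∏ j ∈ I.erase i, p j) = u i := by
  have hM : ∀ J : Finset ι, (∏ i ∈ J, p i) ≠ 0 := fun J =>
    Finset.prod_ne_zero_iff.2 fun i _ => hp i
  rcases eq_or_ne a 0 with rfl | ha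
  · rw [rootMonomial, if_pos rfl]
    refine ⟨zero_pow (hM _), fun i hi => ?_⟩
    rw [zero_pow (hM _), (pow_eq_zero_iff (hp i)).1 (hu i hi)]
  · have hu0 : ∀ i ∈ I, u i ≠ 0 := by
      intro i hi h0
      have := hu i hi
      rw [h0, zero_pow (hp i)] at this
      exact ha this.symm
    obtain ⟨t, ht, hti⟩ := exists_common_root hcop (Units.mk0 a ha)
      (fun i => if h : i ∈ I then Units.mk0 (u i) (hu0 i h) else 1) I (by
        intro i hi
        ext
        simp [hi, hu i hi])
    have ht' : (t : ℂ) ^ (∏ i ∈ I, p i) = a := by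
      rw [← Units.val_pow_eq_pow_val, ht, Units.val_mk0]
    have hti' : ∀ i ∈ I, u i = (t : ℂ) ^ (∏ j ∈ I.erase i, p j) := by
      intro i hi
      rw [← Units.val_pow_eq_pow_val, hti i hi]
      simp [hi]
    have hw := rootMonomial_pow hp hb hti'
    rw [ht'] at hw
    rw [hw]
    exact ⟨ht', fun i hi => (hti' i hi).symm⟩

theorem continuousAt_rootMonomial (hp : ∀ i, p i ≠ 0)
    (hcop : Pairwise fun i j => (p i).Coprime (p j))
    (hb : α * ((∏ i ∈ I, p i : ℕ) : ℤ) + ∑ i ∈ I, β i * ((∏ j ∈ I.erase i, p j : ℕ) : ℤ) = 1)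
    {X : Type} [TopologicalSpace X] {a : X → ℂ} {u : ι → X → ℂ} {x : X}
    (hac : ContinuousAt a x) (huc : ∀ i ∈ I, ContinuousAt (u i) x)
    (hu : ∀ᶠ y in 𝓝 x, ∀ i ∈ I, u i y ^ p i = a y) :
    ContinuousAt (fun y => rootMonomial I α β (a y) fun i => u i y) x := by
  have hM : (∏ i ∈ I, p i) ≠ 0 := Finset.prod_ne_zero_iff.2 fun i _ => hp i
  rcases eq_or_ne (a x) 0 with ha | ha
  · have hval : rootMonomial I α β (a x) (fun i => u i x) = 0 := by rw [rootMonomial, if_pos ha]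
    rw [ContinuousAt, hval, Metric.tendsto_nhds]
    intro ε hε
    -- near a zero of `a` the monomial is small because its power of exponent `∏ p i` is `a`
    rw [ContinuousAt, ha, Metric.tendsto_nhds] at hac
    filter_upwards [hac _ (pow_pos hε (∏ i ∈ I, p i)), hu] with y hy huy
    rw [dist_zero_right] at hy ⊢
    rw [← (rootMonomial_spec hp hcop hb huy).1, norm_pow] at hy
    exact lt_of_pow_lt_pow_left₀ _ hε.le hy
  · have hux : ∀ i ∈ I, u i x ≠ 0 := by
      intro i hi h0
      have := hu.self_of_nhds i hi
      rw [h0, zero_pow (hp i)] at this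
      exact ha this.symm
    have hc : ContinuousAt (fun y => a y ^ α * ∏ i ∈ I, u i y ^ β i) x := by
      refine (hac.zpow₀ α (Or.inl ha)).mul ?_
      exact tendsto_finsetProd _ fun i hi => (huc i hi).zpow₀ (β i) (Or.inl (hux i hi))
    refine hc.congr ?_
    filter_upwards [hac.eventually_ne ha] with y hy
    rw [rootMonomial, if_neg hy]

end Monomial

/-! ### Local charts of the fibre product -/

/-- Near a point where it does not vanish, a continuous function has a continuous `n`-th root with
any prescribed value at the point. -/
theorem exists_continuousOn_root {X : Type} [TopologicalSpace X] {q : X → ℂ} {V : Set X} {b : X}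
    {n : ℕ} {w : ℂ} (hV : IsOpen V) (hb : b ∈ V) (hq : ContinuousOn q V) (h0 : q b ≠ 0)
    (hn : n ≠ 0) (hw : w ^ n = q b) :
    ∃ (k : X → ℂ) (U : Set X), IsOpen U ∧ b ∈ U ∧ U ⊆ V ∧ ContinuousOn k U ∧ k b = w ∧
      ∀ z ∈ U, k z ^ n = q z ∧ k z ≠ 0 := by
  have hq' : ContinuousOn (fun z => q z / q b) V := hq.div_const _
  have hw0 : w ≠ 0 := by rintro rfl; rw [zero_pow hn] at hw; exact h0 hw.symm
  refine ⟨fun z => w * (q z / q b) ^ ((n : ℂ)⁻¹), V ∩ (fun z => q z / q b) ⁻¹' Complex.slitPlane,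
    hq'.isOpen_inter_preimage hV Complex.isOpen_slitPlane, ⟨hb, by simp [h0]⟩,
    inter_subset_left, ?_, by simp [h0], ?_⟩
  · exact continuousOn_const.mul ((hq'.mono inter_subset_left).cpow continuousOn_const
      fun z hz => hz.2)
  · rintro z ⟨-, hz⟩
    have hz0 : q z / q b ≠ 0 := Complex.slitPlane_ne_zero hz
    refine ⟨?_, mul_ne_zero hw0 ?_⟩
    · rw [mul_pow, Complex.cpow_nat_inv_pow _ hn, hw, mul_div_cancel₀ _ h0]
    · rw [Ne, Complex.cpow_eq_zero_iff]
      tauto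

namespace RootSpace

variable {B ι : Type} {p : ι → ℕ} {g : ι → B → ℂ} [TopologicalSpace B] [Fintype ι]

/-- A sheet of the unramified part of the fibre product is open. -/
theorem isOpen_sheet (hp : ∀ i, p i ≠ 0) {U : Set B} (hU : IsOpen U) {J : Set ι}
    {k : ι → B → ℂ} (hk : ∀ i, ContinuousOn (k i) U) (hk0 : ∀ i, ∀ z ∈ U, k i z ≠ 0)
    (hg : ∀ i ∈ J, ∀ z ∈ U, g i z = k i z ^ p i) :
    IsOpen {y : RootSpace p g | y.proj ∈ U ∧ ∀ i ∈ J, y.1.2 i = k i y.proj} := by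
  rw [isOpen_iff_mem_nhds]
  rintro y ⟨hyU, hy⟩
  -- the other `n`-th roots of unity keep away from `1`
  have hO : ∀ n : ℕ, n ≠ 0 → {v : ℂ | v ^ n = 1 → v = 1} ∈ 𝓝 (1 : ℂ) := by
    intro n hn
    have hfin : {v : ℂ | v ^ n = 1 ∧ v ≠ 1}.Finite := by
      refine (Polynomial.nthRoots n (1 : ℂ)).toFinset.finite_toSet.subset ?_
      intro v hv
      simpa [Polynomial.mem_nthRoots (Nat.pos_of_ne_zero hn)] using hv.1
    refine mem_of_superset (hfin.isClosed.isOpen_compl.mem_nhds (by simp)) ?_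
    intro v hv h1
    by_contra hne
    exact hv ⟨h1, hne⟩
  have hπ : ContinuousAt (proj : RootSpace p g → B) y := continuous_proj.continuousAt
  have hUev : ∀ᶠ y' : RootSpace p g in 𝓝 y, y'.proj ∈ U := hπ (hU.mem_nhds hyU)
  have hall : ∀ᶠ y' : RootSpace p g in 𝓝 y, ∀ i, i ∈ J → y'.1.2 i = k i y'.proj := by
    rw [eventually_all]
    intro i
    by_cases hi : i ∈ J
    · have hk' : ContinuousAt (fun y' : RootSpace p g => k i y'.proj) y :=
        ContinuousAt.comp (f := proj) ((hk i).continuousAt (hU.mem_nhds hyU)) hπ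
      have hc : ContinuousAt (fun y' : RootSpace p g => y'.1.2 i / k i y'.proj) y :=
        (continuous_coord i).continuousAt.div hk' (hk0 i _ hyU)
      have hone : y.1.2 i / k i y.proj = 1 := by rw [hy i hi, div_self (hk0 i _ hyU)]
      rw [ContinuousAt, hone] at hc
      filter_upwards [hc (hO (p i) (hp i)), hUev] with y' hy' hyU' _
      rw [← div_eq_one_iff_eq (hk0 i _ hyU')]
      apply hy'
      rw [div_pow, y'.2 i, hg i hi _ hyU', div_self (pow_ne_zero _ (hk0 i _ hyU'))]
    · exact Eventually.of_forall fun _ h => absurd h hi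
  filter_upwards [hUev, hall] with y' h1 h2 using ⟨h1, h2⟩

/-- The local chart at a point of the fibre product over which the `i`-th root is ramified exactly
for `i ∈ I`: the coordinate is the common root `t` of the base coordinate `φ` of which the `w i`,
`i ∈ I`, are powers up to the units `k i`. -/
theorem exists_chart_of_roots [DecidableEq ι] (hp : ∀ i, p i ≠ 0)
    (hcop : Pairwise fun i j => (p i).Coprime (p j)) (I : Finset ι) (φ : OpenPartialHomeomorph B ℂ)
    {k : ι → B → ℂ} (hk : ∀ i, ContinuousOn (k i) φ.source) (hk0 : ∀ i, ∀ z ∈ φ.source, k i z ≠ 0)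
    (hgI : ∀ i ∈ I, ∀ z ∈ φ.source, g i z = φ z * k i z ^ p i)
    (hgJ : ∀ i ∉ I, ∀ z ∈ φ.source, g i z = k i z ^ p i)
    (x : RootSpace p g) (hx : x.proj ∈ φ.source) (hx0 : φ x.proj = 0)
    (hxJ : ∀ i ∉ I, x.1.2 i = k i x.proj) :
    ∃ e : OpenPartialHomeomorph (RootSpace p g) ℂ, x ∈ e.source ∧ e x = 0 ∧
      ∀ y ∈ e.source, y.proj ∈ φ.source ∧ φ y.proj = e y ^ ∏ i ∈ I, p i := by
  obtain ⟨α, β, hb⟩ := exists_bezout_prod_erase hcop I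
  have hu : ∀ y : RootSpace p g, y.proj ∈ φ.source → ∀ i ∈ I,
      (y.1.2 i / k i y.proj) ^ p i = φ y.proj := by
    intro y hy i hi
    rw [div_pow, y.2 i, hgI i hi _ hy, mul_div_cancel_right₀ _ (pow_ne_zero _ (hk0 i _ hy))]
  let s : RootSpace p g → ℂ := fun y =>
    rootMonomial I α β (φ y.proj) fun i => y.1.2 i / k i y.proj
  have hs : ∀ y : RootSpace p g, y.proj ∈ φ.source → s y ^ (∏ i ∈ I, p i) = φ y.proj ∧
      ∀ i ∈ I, s y ^ (∏ j ∈ I.erase i, p j) = y.1.2 i / k i y.proj := fun y hy =>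
    rootMonomial_spec hp hcop hb (hu y hy)
  let c : ℂ → B × (ι → ℂ) := fun t =>
    (φ.symm (t ^ ∏ i ∈ I, p i), fun i =>
      (if i ∈ I then t ^ (∏ j ∈ I.erase i, p j) else 1) * k i (φ.symm (t ^ ∏ i ∈ I, p i)))
  have hc : ∀ t : ℂ, t ^ (∏ i ∈ I, p i) ∈ φ.target → ∀ i, (c t).2 i ^ p i = g i (c t).1 := by
    intro t ht i
    have hz := φ.map_target ht
    by_cases hi : i ∈ I
    · simp only [c, if_pos hi]
      rw [hgI i hi _ hz, φ.right_inv ht, mul_pow, ← pow_mul, Finset.prod_erase_mul _ _ hi]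
    · simp only [c, if_neg hi, one_mul]
      rw [hgJ i hi _ hz]
  classical
  let τ : ℂ → RootSpace p g := fun t =>
    if h : t ^ (∏ i ∈ I, p i) ∈ φ.target then ⟨c t, hc t h⟩ else x
  have hτ : ∀ t : ℂ, t ^ (∏ i ∈ I, p i) ∈ φ.target → (τ t).1 = c t := by
    intro t ht
    simp only [τ, dif_pos ht]
  have hsτ : ∀ t : ℂ, t ^ (∏ i ∈ I, p i) ∈ φ.target → s (τ t) = t := by
    intro t ht
    simp only [s, proj, hτ t ht]
    have h1 : φ (c t).1 = t ^ ∏ i ∈ I, p i := φ.right_inv ht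
    rw [h1]
    refine rootMonomial_pow hp hb fun i hi => ?_
    simp only [c, if_pos hi]
    exact mul_div_cancel_right₀ _ (hk0 i _ (φ.map_target ht))
  let e : OpenPartialHomeomorph (RootSpace p g) ℂ :=
    { toFun := s
      invFun := τ
      source := {y | y.proj ∈ φ.source ∧ ∀ i ∈ {i | i ∉ I}, y.1.2 i = k i y.proj}
      target := {t | t ^ (∏ i ∈ I, p i) ∈ φ.target}
      map_source' := by
        rintro y ⟨hy, -⟩
        change s y ^ _ ∈ φ.target
        rw [(hs y hy).1]
        exact φ.map_source hy
      map_target' := by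
        intro t ht
        refine ⟨?_, fun i hi => ?_⟩
        · rw [proj, hτ t ht]
          exact φ.map_target ht
        · rw [proj, hτ t ht]
          simp only [c, if_neg (show i ∉ I from hi), one_mul]
      left_inv' := by
        rintro y ⟨hy, hyJ⟩
        have ht : s y ^ (∏ i ∈ I, p i) ∈ φ.target := by
          rw [(hs y hy).1]
          exact φ.map_source hy
        refine Subtype.ext ?_
        change (τ (s y)).1 = y.1
        rw [hτ _ ht]
        have h1 : φ.symm (s y ^ ∏ i ∈ I, p i) = y.proj := by rw [(hs y hy).1, φ.left_inv hy]
        refine Prod.ext h1 (funext fun i => ?_)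
        simp only [c, h1]
        by_cases hi : i ∈ I
        · rw [if_pos hi, (hs y hy).2 i hi, div_mul_cancel₀ _ (hk0 i _ hy)]
        · rw [if_neg hi, one_mul, hyJ i hi]
      right_inv' := hsτ
      open_source := isOpen_sheet hp φ.open_source hk hk0 hgJ
      open_target := φ.open_target.preimage (continuous_pow _)
      continuousOn_toFun := by
        rintro y ⟨hy, -⟩
        refine ContinuousAt.continuousWithinAt ?_
        have hπ : ContinuousAt (proj : RootSpace p g → B) y := continuous_proj.continuousAt
        refine continuousAt_rootMonomial hp hcop hb
          (ContinuousAt.comp (f := proj) (φ.continuousAt hy) hπ)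
          (fun i _ => (continuous_coord i).continuousAt.div
            (ContinuousAt.comp (f := proj) ((hk i).continuousAt (φ.open_source.mem_nhds hy)) hπ)
            (hk0 i _ hy)) ?_
        filter_upwards [hπ (φ.open_source.mem_nhds hy)] with y' hy'
        exact hu y' hy'
      continuousOn_invFun := by
        refine IsInducing.subtypeVal.continuousOn_iff.2 ?_
        have hpow : ContinuousOn (fun t : ℂ => φ.symm (t ^ ∏ i ∈ I, p i))
            {t | t ^ (∏ i ∈ I, p i) ∈ φ.target} :=
          φ.continuousOn_symm.comp (continuous_pow _).continuousOn fun t ht => ht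
        have hcc : ContinuousOn c {t | t ^ (∏ i ∈ I, p i) ∈ φ.target} := by
          refine hpow.prodMk (continuousOn_pi.2 fun i => ContinuousOn.mul ?_ ?_)
          · split_ifs
            · exact (continuous_pow _).continuousOn
            · exact continuousOn_const
          · exact (hk i).comp hpow fun t ht => φ.map_target ht
        exact hcc.congr fun t ht => hτ t ht }
  refine ⟨e, ⟨hx, hxJ⟩, ?_, fun y hy => ⟨hy.1, (hs y hy.1).1.symm⟩⟩
  change rootMonomial I α β (φ x.proj) _ = 0
  rw [rootMonomial, if_pos hx0]

/-- The projection of the fibre product is a power map at every point near which the ramified `g i`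
have simple zeros in the coordinate `φ`. -/
theorem exists_chart (hp : ∀ i, p i ≠ 0) (hcop : Pairwise fun i j => (p i).Coprime (p j))
    (x : RootSpace p g) (φ : OpenPartialHomeomorph B ℂ) (hx : x.proj ∈ φ.source)
    (hx0 : φ x.proj = 0)
    (hg : ∀ i, ∃ q : B → ℂ, ContinuousOn q φ.source ∧ q x.proj ≠ 0 ∧
      ((∀ z ∈ φ.source, g i z = φ z * q z) ∨ (∀ z ∈ φ.source, g i z = q z))) :
    ∃ e : OpenPartialHomeomorph (RootSpace p g) ℂ, x ∈ e.source ∧ e x = 0 ∧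
      ∀ y ∈ e.source, y.proj ∈ φ.source ∧ φ y.proj = e y ^ ramification p g x.proj := by
  classical
  choose q hqc hq0 hgq using hg
  have hI : ∀ i, g i x.proj = 0 → ∀ z ∈ φ.source, g i z = φ z * q i z := by
    intro i hi
    refine (hgq i).resolve_right fun h => hq0 i ?_
    rw [← h _ hx, hi]
  have hJ : ∀ i, g i x.proj ≠ 0 → ∀ z ∈ φ.source, g i z = q i z := by
    intro i hi
    refine (hgq i).resolve_left fun h => hi ?_
    rw [h _ hx, hx0, zero_mul]
  have hw : ∀ i, ∃ w : ℂ, w ^ p i = q i x.proj ∧ (g i x.proj ≠ 0 → w = x.1.2 i) := by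
    intro i
    by_cases hi : g i x.proj = 0
    · obtain ⟨w, hw⟩ := IsAlgClosed.exists_pow_nat_eq (q i x.proj) (Nat.pos_of_ne_zero (hp i))
      exact ⟨w, hw, fun h => absurd hi h⟩
    · exact ⟨x.1.2 i, by rw [x.2 i]; exact hJ i hi _ hx, fun _ => rfl⟩
  choose w hw hwx using hw
  choose k U hUo hxU hUφ hkc hkw hkq using fun i =>
    exists_continuousOn_root φ.open_source hx (hqc i) (hq0 i) (hp i) (hw i)
  let V : Set B := ⋂ i, U i
  have hV : IsOpen V := isOpen_iInter_of_finite hUo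
  let ψ := φ.restrOpen V hV
  have hψ : ∀ z ∈ ψ.source, z ∈ φ.source ∧ ∀ i, z ∈ U i := by
    intro z hz
    rw [OpenPartialHomeomorph.restrOpen_source] at hz
    exact ⟨hz.1, mem_iInter.1 hz.2⟩
  have hxψ : x.proj ∈ ψ.source := by
    rw [OpenPartialHomeomorph.restrOpen_source]
    exact ⟨hx, mem_iInter.2 hxU⟩
  obtain ⟨e, he, he0, h⟩ := exists_chart_of_roots hp hcop
    (Finset.univ.filter fun i => g i x.proj = 0) ψ
    (fun i => (hkc i).mono fun z hz => (hψ z hz).2 i)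
    (fun i z hz => (hkq i z ((hψ z hz).2 i)).2)
    (fun i hi z hz => by
      rw [(hkq i z ((hψ z hz).2 i)).1]
      exact hI i (Finset.mem_filter.1 hi).2 z (hψ z hz).1)
    (fun i hi z hz => by
      rw [(hkq i z ((hψ z hz).2 i)).1]
      exact hJ i (by simpa using hi) z (hψ z hz).1)
    x hxψ hx0 (fun i hi => by rw [hkw i, hwx i (by simpa using hi)])
  refine ⟨e, he, he0, fun y hy => ⟨(hψ _ (h y hy).1).1, ?_⟩⟩
  rw [ramification]
  exact (h y hy).2

end RootSpace

/-! ### Connectedness of cyclic branched covers -/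

/-- A locally connected cyclic branched cover of a connected space is connected if the generator `f`
has fixed points of two coprime powers: every connected component maps onto the base, so it contains
such fixed points and is preserved by both powers, hence by `f`. -/
theorem preconnectedSpace_of_orbit_fibres {F B : Type} [TopologicalSpace F] [TopologicalSpace B]
    [CompactSpace F] [LocallyConnectedSpace F] [T2Space B] [ConnectedSpace B] {f : F ≃ₜ F}
    {π : F → B} (hπ : Continuous π) (hsurj : Function.Surjective π)
    (hfib : ∀ x y, π x = π y ↔ y ∈ mapOrbit f x) {m n : ℤ} (hmn : IsCoprime m n) {b c : B}
    (hb : ∀ x, π x = b → ∀ k, m ∣ k → (f ^ k) x = x)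
    (hc : ∀ x, π x = c → ∀ k, n ∣ k → (f ^ k) x = x) : PreconnectedSpace F := by
  obtain ⟨b₀⟩ : Nonempty B := inferInstance
  obtain ⟨x₀, -⟩ := hsurj b₀
  set C := connectedComponent x₀ with hC
  have hopenπ : IsOpenMap π := by
    intro U hU
    have hq : IsQuotientMap π := hπ.isClosedMap.isQuotientMap hπ hsurj
    rw [← hq.isOpen_preimage]
    have : π ⁻¹' (π '' U) = ⋃ k : ℤ, (f ^ k) '' U := by
      ext y
      simp only [mem_preimage, mem_image, mem_iUnion]
      constructor
      · rintro ⟨x, hx, hxy⟩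
        obtain ⟨k, hk⟩ := (hfib x y).1 hxy
        exact ⟨k, x, hx, hk⟩
      · rintro ⟨k, x, hx, hk⟩
        exact ⟨x, hx, (hfib x y).2 ⟨k, hk⟩⟩
    rw [this]
    exact isOpen_iUnion fun k => (f ^ k).isOpenMap _ hU
  have himg : π '' C = univ :=
    IsClopen.eq_univ ⟨hπ.isClosedMap _ isClosed_connectedComponent,
      hopenπ _ isOpen_connectedComponent⟩ ⟨π x₀, x₀, mem_connectedComponent, rfl⟩
  have hpres : ∀ (k : ℤ) (z : F), z ∈ C → (f ^ k) z = z → ∀ y ∈ C, (f ^ k) y ∈ C := by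
    intro k z hz hkz y hy
    have h1 := (f ^ k).continuous.image_connectedComponent_subset z
    rw [hkz, ← connectedComponent_eq hz] at h1
    exact h1 ⟨y, hy, rfl⟩
  obtain ⟨x, hxC, hx⟩ : b ∈ π '' C := himg ▸ mem_univ b
  obtain ⟨y, hyC, hy⟩ : c ∈ π '' C := himg ▸ mem_univ c
  have hall : C = univ := by
    refine eq_univ_of_forall fun z => ?_
    obtain ⟨w, hwC, hw⟩ : π z ∈ π '' C := himg ▸ mem_univ _
    obtain ⟨k, rfl⟩ := (hfib w z).1 hw
    obtain ⟨α, β, hαβ⟩ := hmn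
    have hk : k = k * α * m + k * β * n := by linear_combination -k * hαβ
    rw [hk, zpow_add, Homeomorph.mul_apply]
    exact hpres _ x hxC (hb x hx _ (dvd_mul_left _ _)) _
      (hpres _ y hyC (hc y hy _ (dvd_mul_left _ _)) _ hwC)
  exact ⟨hall ▸ isPreconnected_connectedComponent⟩

/-! ### The Riemann sphere -/

namespace RiemannSphere

open OnePoint ComplexConjugate

/-- The inversion `z ↦ 1 / z` of the Riemann sphere. -/
noncomputable def inversion (z : OnePoint ℂ) : OnePoint ℂ :=
  z.elim ((0 : ℂ) : OnePoint ℂ) fun z =>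
    open Classical in if z = 0 then infty else ((z⁻¹ : ℂ) : OnePoint ℂ)

@[simp] theorem inversion_infty : inversion infty = ((0 : ℂ) : OnePoint ℂ) := rfl

@[simp] theorem inversion_zero : inversion ((0 : ℂ) : OnePoint ℂ) = infty := if_pos rfl

theorem inversion_coe {z : ℂ} (hz : z ≠ 0) : inversion (z : OnePoint ℂ) = ((z⁻¹ : ℂ) : OnePoint ℂ) :=
  if_neg hz

theorem inversion_inversion (z : OnePoint ℂ) : inversion (inversion z) = z := by
  induction z using OnePoint.rec with
  | infty => simp
  | coe z =>
    by_cases hz : z = 0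
    · simp [hz]
    · rw [inversion_coe hz, inversion_coe (inv_ne_zero hz), inv_inv]

theorem continuous_inversion : Continuous inversion := by
  rw [OnePoint.continuous_iff, coclosedCompact_eq_cocompact, ← Metric.cobounded_eq_cocompact]
  constructor
  · refine ((continuous_coe.tendsto (0 : ℂ)).comp tendsto_inv₀_cobounded).congr' ?_
    filter_upwards [Bornology.eventually_ne_cobounded (0 : ℂ)] with z hz
    exact (inversion_coe hz).symm
  · rw [continuous_iff_continuousAt]
    intro z
    by_cases hz : z = 0
    · subst hz
      rw [continuousAt_iff_punctured_nhds, inversion_zero]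
      have h1 : Tendsto ((↑) : ℂ → OnePoint ℂ) (Bornology.cobounded ℂ) (𝓝 infty) := by
        rw [Metric.cobounded_eq_cocompact, ← coclosedCompact_eq_cocompact]
        exact tendsto_coe_infty
      refine (h1.comp tendsto_inv₀_nhdsNE_zero).congr' ?_
      filter_upwards [self_mem_nhdsWithin] with w hw
      exact (inversion_coe hw).symm
    · have : ContinuousAt (fun w : ℂ => ((w⁻¹ : ℂ) : OnePoint ℂ)) z :=
        ContinuousAt.comp continuous_coe.continuousAt (continuousAt_inv₀ hz)
      refine this.congr ?_
      filter_upwards [isOpen_ne.mem_nhds hz] with w hw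
      exact (inversion_coe hw).symm

/-- `inversion` as a homeomorphism. -/
noncomputable def inversionHomeomorph : OnePoint ℂ ≃ₜ OnePoint ℂ where
  toFun := inversion
  invFun := inversion
  left_inv := inversion_inversion
  right_inv := inversion_inversion
  continuous_toFun := continuous_inversion
  continuous_invFun := continuous_inversion

/-- The affine coordinate `z` of the Riemann sphere. -/
noncomputable def coord : OpenPartialHomeomorph (OnePoint ℂ) ℂ :=
  (isOpenEmbedding_coe.toOpenPartialHomeomorph ((↑) : ℂ → OnePoint ℂ)).symm

theorem coord_source : coord.source = range ((↑) : ℂ → OnePoint ℂ) := by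
  simp [coord]

@[simp] theorem coord_symm_apply (z : ℂ) : coord.symm z = (z : OnePoint ℂ) := by
  simp [coord]

@[simp] theorem coord_coe (z : ℂ) : coord (z : OnePoint ℂ) = z := by
  have h : z ∈ coord.target := by simp [coord]
  rw [← coord_symm_apply, coord.right_inv h]

/-- The affine coordinate `z - a` centred at `a`. -/
noncomputable def coordAt (a : ℂ) : OpenPartialHomeomorph (OnePoint ℂ) ℂ :=
  coord.transHomeomorph (Homeomorph.subRight a)

/-- The coordinate `1 / z` centred at `∞`. -/
noncomputable def coordInfty : OpenPartialHomeomorph (OnePoint ℂ) ℂ :=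
  inversionHomeomorph.transOpenPartialHomeomorph coord

theorem coordAt_source (a : ℂ) : (coordAt a).source = range ((↑) : ℂ → OnePoint ℂ) := by
  simp [coordAt, coord_source]

@[simp] theorem coordAt_coe (a z : ℂ) : coordAt a (z : OnePoint ℂ) = z - a := by
  simp [coordAt]

@[simp] theorem coordAt_symm_apply (a z : ℂ) : (coordAt a).symm z = ((z + a : ℂ) : OnePoint ℂ) := by
  simp [coordAt]

@[simp] theorem coordInfty_apply (z : OnePoint ℂ) : coordInfty z = coord (inversion z) := rfl

@[simp] theorem coordInfty_symm_apply (z : ℂ) : coordInfty.symm z = inversion (z : OnePoint ℂ) := by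
  rw [← coord_symm_apply]
  rfl

theorem mem_coordInfty_source {z : OnePoint ℂ} : z ∈ coordInfty.source ↔ inversion z ≠ infty := by
  rw [ne_infty_iff_exists, ← mem_range, ← coord_source]
  rfl

/-- The holomorphic atlas of the Riemann sphere by the centred coordinates. -/
def centredAtlas : Set (OpenPartialHomeomorph (OnePoint ℂ) ℂ) :=
  insert coordInfty (range coordAt)

theorem differentiableOn_coordChange (φ : OpenPartialHomeomorph (OnePoint ℂ) ℂ)
    (hφ : φ ∈ centredAtlas) (ψ : OpenPartialHomeomorph (OnePoint ℂ) ℂ) (hψ : ψ ∈ centredAtlas) :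
    DifferentiableOn ℂ (ψ ∘ φ.symm) (φ.symm.trans ψ).source := by
  rcases hφ with rfl | ⟨a, rfl⟩ <;> rcases hψ with rfl | ⟨b, rfl⟩
  · refine differentiableOn_id.congr fun z hz => ?_
    simp [inversion_inversion]
  · have h0 : ∀ z ∈ (coordInfty.symm.trans (coordAt b)).source, z ≠ 0 := by
      rintro z ⟨-, hz⟩ rfl
      have h1 : coordInfty.symm 0 ∈ (coordAt b).source := hz
      rw [coordAt_source, coordInfty_symm_apply, inversion_zero] at h1
      exact infty_notMem_range_coe h1
    refine DifferentiableOn.congr (f := fun z : ℂ => z⁻¹ - b)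
      (fun z hz => ((differentiableAt_inv (h0 z hz)).sub_const b).differentiableWithinAt)
      fun z hz => ?_
    simp [inversion_coe (h0 z hz)]
  · have h0 : ∀ z ∈ ((coordAt a).symm.trans coordInfty).source, z + a ≠ 0 := by
      rintro z ⟨-, hz⟩ h
      have h1 : (coordAt a).symm z ∈ coordInfty.source := hz
      rw [mem_coordInfty_source, coordAt_symm_apply, h, inversion_zero] at h1
      exact h1 rfl
    refine DifferentiableOn.congr (f := fun z : ℂ => (z + a)⁻¹)
      (fun z hz => ((differentiableAt_id.add_const a).inv (h0 z hz)).differentiableWithinAt)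
      fun z hz => ?_
    simp [inversion_coe (h0 z hz)]
  · refine DifferentiableOn.congr (f := fun z : ℂ => z + a - b)
      ((differentiableOn_id.add_const a).sub_const b) fun z hz => ?_
    simp

/-! ### Functions on the sphere with prescribed zeros -/

/-- The function `(z - a) * conj (z - b) / (1 + |z| ^ 2)` on the Riemann sphere, with value `1` at
`∞`. It is continuous, with a simple zero at `a` and, in a coordinate reversing the orientation, a
simple zero at `b`. -/
noncomputable def dipole (a b : ℂ) (z : OnePoint ℂ) : ℂ :=
  z.elim 1 fun z => (z - a) * conj (z - b) / (1 + z * conj z)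

@[simp] theorem dipole_infty (a b : ℂ) : dipole a b infty = 1 := rfl

theorem dipole_coe (a b z : ℂ) :
    dipole a b (z : OnePoint ℂ) = (z - a) * conj (z - b) / (1 + z * conj z) := rfl

theorem one_add_mul_conj_ne_zero (z : ℂ) : 1 + z * conj z ≠ 0 := by
  rw [Complex.mul_conj]
  have : (0 : ℝ) < 1 + Complex.normSq z := by positivity [Complex.normSq_nonneg z]
  exact_mod_cast this.ne'

theorem dipole_coe_eq_zero_iff {a b z : ℂ} : dipole a b (z : OnePoint ℂ) = 0 ↔ z = a ∨ z = b := by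
  rw [dipole_coe, div_eq_zero_iff, or_iff_left (one_add_mul_conj_ne_zero z), mul_eq_zero,
    map_eq_zero, sub_eq_zero, sub_eq_zero]

theorem continuous_dipole (a b : ℂ) : Continuous (dipole a b) := by
  rw [OnePoint.continuous_iff, coclosedCompact_eq_cocompact, ← Metric.cobounded_eq_cocompact]
  constructor
  · -- in the coordinate `w = 1 / z` the function is again a quotient without poles
    have h1 : Continuous fun w : ℂ => (1 - a * w) * (1 - conj b * conj w) / (1 + w * conj w) :=
      Continuous.div (by fun_prop) (by fun_prop) one_add_mul_conj_ne_zero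
    have h2 : Tendsto (fun w : ℂ => (1 - a * w) * (1 - conj b * conj w) / (1 + w * conj w)) (𝓝 0)
        (𝓝 1) := by simpa using h1.tendsto 0
    refine (h2.comp tendsto_inv₀_cobounded).congr' ?_
    filter_upwards [Bornology.eventually_ne_cobounded (0 : ℂ)] with z hz
    have hz' : conj z ≠ 0 := (map_ne_zero _).2 hz
    have h3 := one_add_mul_conj_ne_zero z
    have h4 := one_add_mul_conj_ne_zero z⁻¹
    rw [map_inv₀] at h4
    rw [Function.comp_apply, dipole_coe, map_inv₀, div_eq_div_iff h4 h3, map_sub]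
    have hz0 : z ≠ 0 := hz
    generalize conj z = v at *
    field_simp
    ring
  · exact Continuous.div (by fun_prop) (by fun_prop) one_add_mul_conj_ne_zero

/-- Complex conjugation as a homeomorphism. -/
noncomputable def conjHomeomorph : ℂ ≃ₜ ℂ := Complex.conjCLE.toHomeomorph

@[simp] theorem conjHomeomorph_apply (z : ℂ) : conjHomeomorph z = conj z := rfl

theorem exists_dipole_eq_coordAt_mul {a b : ℂ} (hab : a ≠ b) :
    ∃ r : OnePoint ℂ → ℂ, ContinuousOn r (coordAt a).source ∧ r a ≠ 0 ∧
      ∀ z ∈ (coordAt a).source, dipole a b z = coordAt a z * r z := by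
  refine ⟨fun z => z.elim 0 fun z => conj (z - b) / (1 + z * conj z), ?_, ?_, ?_⟩
  · rw [coordAt_source]
    rintro _ ⟨z, rfl⟩
    refine ContinuousAt.continuousWithinAt (continuousAt_coe.2 (Continuous.continuousAt ?_))
    exact Continuous.div (by fun_prop) (by fun_prop) one_add_mul_conj_ne_zero
  · exact div_ne_zero ((map_ne_zero _).2 (sub_ne_zero.2 hab)) (one_add_mul_conj_ne_zero a)
  · rw [coordAt_source]
    rintro _ ⟨z, rfl⟩
    rw [dipole_coe, coordAt_coe, mul_div_assoc]
    rfl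

theorem exists_dipole_eq_conj_coordAt_mul {a b : ℂ} (hab : a ≠ b) :
    ∃ r : OnePoint ℂ → ℂ, ContinuousOn r (coordAt b).source ∧ r b ≠ 0 ∧
      ∀ z ∈ (coordAt b).source, dipole a b z = conj (coordAt b z) * r z := by
  refine ⟨fun z => z.elim 0 fun z => (z - a) / (1 + z * conj z), ?_, ?_, ?_⟩
  · rw [coordAt_source]
    rintro _ ⟨z, rfl⟩
    refine ContinuousAt.continuousWithinAt (continuousAt_coe.2 (Continuous.continuousAt ?_))
    exact Continuous.div (by fun_prop) (by fun_prop) one_add_mul_conj_ne_zero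
  · exact div_ne_zero (sub_ne_zero.2 hab.symm) (one_add_mul_conj_ne_zero b)
  · rw [coordAt_source]
    rintro _ ⟨z, rfl⟩
    rw [dipole_coe, coordAt_coe, mul_comm (z - a), mul_div_assoc]
    rfl

end RiemannSphere

/-! ### The branched cover of the sphere -/

namespace RiemannSphere

open OnePoint ComplexConjugate

section Branched

variable {ι : Type} {c : ι × Fin 2 → ℂ} {p : ι → ℕ}

theorem dipole_branch_eq_zero_iff (hc : Function.Injective c) {j k : ι} {s : Fin 2} :
    dipole (c (k, 0)) (c (k, 1)) (c (j, s)) = 0 ↔ k = j := by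
  rw [dipole_coe_eq_zero_iff, hc.eq_iff, hc.eq_iff, Prod.ext_iff, Prod.ext_iff]
  constructor
  · rintro (h | h) <;> exact h.1.symm
  · rintro rfl
    fin_cases s <;> simp

theorem dipole_ne_zero_of_notMem {z : OnePoint ℂ}
    (hz : z ∉ range fun js => (c js : OnePoint ℂ)) (j : ι) :
    dipole (c (j, 0)) (c (j, 1)) z ≠ 0 := by
  induction z using OnePoint.rec with
  | infty => simp
  | coe z =>
    rw [Ne, dipole_coe_eq_zero_iff]
    rintro (rfl | rfl) <;> exact hz ⟨_, rfl⟩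

theorem infty_notMem_range_branch : infty ∉ range fun js => (c js : OnePoint ℂ) := by
  rintro ⟨js, h⟩
  exact coe_ne_infty _ h

variable [Fintype ι] [DecidableEq ι]

/-- The product over `j ≠ i` of the dipoles with zeros `c (j, 0)` and `c (j, 1)`: the function whose
`i`-th root is ramified at the points `c (j, s)` with `j ≠ i`. -/
noncomputable def branchFun (c : ι × Fin 2 → ℂ) (i : ι) (z : OnePoint ℂ) : ℂ :=
  ∏ j ∈ Finset.univ.erase i, dipole (c (j, 0)) (c (j, 1)) z

theorem continuous_branchFun (c : ι × Fin 2 → ℂ) (i : ι) : Continuous (branchFun c i) :=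
  continuous_finsetProd _ fun _ _ => continuous_dipole _ _

theorem branchFun_branch_eq_zero_iff (hc : Function.Injective c) {i j : ι} {s : Fin 2} :
    branchFun c i (c (j, s)) = 0 ↔ i ≠ j := by
  rw [branchFun, Finset.prod_eq_zero_iff]
  simp only [dipole_branch_eq_zero_iff hc, Finset.mem_erase, Finset.mem_univ, and_true]
  constructor
  · rintro ⟨k, hk, rfl⟩
    exact hk.symm
  · exact fun h => ⟨j, h.symm, rfl⟩

theorem branchFun_ne_zero_of_notMem {z : OnePoint ℂ}
    (hz : z ∉ range fun js => (c js : OnePoint ℂ)) (i : ι) : branchFun c i z ≠ 0 :=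
  Finset.prod_ne_zero_iff.2 fun j _ => dipole_ne_zero_of_notMem hz j

theorem fibreCard_branch (hc : Function.Injective c) (j : ι) (s : Fin 2) :
    RootSpace.fibreCard p (branchFun c) (c (j, s)) = p j := by
  rw [RootSpace.fibreCard, Finset.prod_eq_single j]
  · intro i hi hij
    exact absurd ((branchFun_branch_eq_zero_iff hc).2 hij) (Finset.mem_filter.1 hi).2
  · intro h
    exact absurd (by simp [branchFun_branch_eq_zero_iff hc]) h

theorem fibreCard_of_notMem {z : OnePoint ℂ} (hz : z ∉ range fun js => (c js : OnePoint ℂ)) :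
    RootSpace.fibreCard p (branchFun c) z = ∏ i, p i := by
  rw [RootSpace.fibreCard, Finset.filter_true_of_mem fun i _ => branchFun_ne_zero_of_notMem hz i]

/-- If the dipole of index `j` is `φ` times a unit and the others do not vanish, each product of
dipoles is a unit or `φ` times a unit. -/
theorem exists_branchFun_factor {φ : OpenPartialHomeomorph (OnePoint ℂ) ℂ} {z : OnePoint ℂ} {j : ι}
    (hz : ∀ k ≠ j, dipole (c (k, 0)) (c (k, 1)) z ≠ 0)
    (hj : ∃ r : OnePoint ℂ → ℂ, ContinuousOn r φ.source ∧ r z ≠ 0 ∧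
      ∀ w ∈ φ.source, dipole (c (j, 0)) (c (j, 1)) w = φ w * r w) (i : ι) :
    ∃ q : OnePoint ℂ → ℂ, ContinuousOn q φ.source ∧ q z ≠ 0 ∧
      ((∀ w ∈ φ.source, branchFun c i w = φ w * q w) ∨
        (∀ w ∈ φ.source, branchFun c i w = q w)) := by
  obtain ⟨r, hrc, hr0, hr⟩ := hj
  by_cases hij : j = i
  · subst hij
    exact ⟨branchFun c j, (continuous_branchFun c j).continuousOn,
      Finset.prod_ne_zero_iff.2 fun k hk => hz k (Finset.ne_of_mem_erase hk),
      Or.inr fun _ _ => rfl⟩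
  · refine ⟨fun w => r w * ∏ k ∈ (Finset.univ.erase i).erase j, dipole (c (k, 0)) (c (k, 1)) w,
      hrc.mul (continuous_finsetProd _ fun _ _ => continuous_dipole _ _).continuousOn,
      mul_ne_zero hr0 (Finset.prod_ne_zero_iff.2 fun k hk => hz k (Finset.ne_of_mem_erase hk)),
      Or.inl fun w hw => ?_⟩
    rw [branchFun, ← Finset.mul_prod_erase _ _ (show j ∈ Finset.univ.erase i by simp [hij]),
      hr w hw, mul_assoc]

/-- At each point of the sphere some coordinate, holomorphic or antiholomorphic, has the properties
required by `RootSpace.exists_chart`. -/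
theorem exists_coord_branchFun_factor (hc : Function.Injective c) (z : OnePoint ℂ) :
    ∃ φ ∈ centredAtlas, ∃ ψ : OpenPartialHomeomorph (OnePoint ℂ) ℂ,
      (ψ = φ ∨ ψ = φ.transHomeomorph conjHomeomorph) ∧ z ∈ ψ.source ∧ ψ z = 0 ∧
      ∀ i, ∃ q : OnePoint ℂ → ℂ, ContinuousOn q ψ.source ∧ q z ≠ 0 ∧
        ((∀ w ∈ ψ.source, branchFun c i w = ψ w * q w) ∨
          (∀ w ∈ ψ.source, branchFun c i w = q w)) := by
  by_cases hz : z ∈ range fun js => (c js : OnePoint ℂ)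
  · obtain ⟨⟨j, s⟩, rfl⟩ := hz
    have hne : c (j, 0) ≠ c (j, 1) := fun h => by simpa using hc h
    have hk : ∀ k ≠ j, dipole (c (k, 0)) (c (k, 1)) (c (j, s)) ≠ 0 := fun k hkj h =>
      hkj ((dipole_branch_eq_zero_iff hc).1 h)
    refine ⟨coordAt (c (j, s)), mem_insert_of_mem _ (mem_range_self _), ?_⟩
    fin_cases s
    · exact ⟨coordAt (c (j, 0)), Or.inl rfl, by simp [coordAt_source], by simp,
        exists_branchFun_factor hk (exists_dipole_eq_coordAt_mul hne)⟩
    · exact ⟨(coordAt (c (j, 1))).transHomeomorph conjHomeomorph, Or.inr rfl,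
        by simp [coordAt_source], by simp,
        exists_branchFun_factor hk (exists_dipole_eq_conj_coordAt_mul hne)⟩
  · have hq : ∀ (ψ : OpenPartialHomeomorph (OnePoint ℂ) ℂ) (i : ι), ∃ q : OnePoint ℂ → ℂ,
        ContinuousOn q ψ.source ∧ q z ≠ 0 ∧
        ((∀ w ∈ ψ.source, branchFun c i w = ψ w * q w) ∨
          (∀ w ∈ ψ.source, branchFun c i w = q w)) := fun ψ i =>
      ⟨branchFun c i, (continuous_branchFun c i).continuousOn, branchFun_ne_zero_of_notMem hz i,
        Or.inr fun _ _ => rfl⟩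
    induction z using OnePoint.rec with
    | infty =>
      exact ⟨coordInfty, mem_insert _ _, coordInfty, Or.inl rfl,
        mem_coordInfty_source.2 (by simp), by simp, hq _⟩
    | coe z =>
      exact ⟨coordAt z, mem_insert_of_mem _ (mem_range_self _), coordAt z, Or.inl rfl,
        by simp [coordAt_source], by simp, hq _⟩

theorem exists_chart_branchFun (hc : Function.Injective c) (hp : ∀ i, p i ≠ 0)
    (hcop : Pairwise fun i j => (p i).Coprime (p j)) (x : RootSpace p (branchFun c)) :
    ∃ φ ∈ centredAtlas, ∃ e : OpenPartialHomeomorph (RootSpace p (branchFun c)) ℂ,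
      x ∈ e.source ∧ e x = 0 ∧ x.proj ∈ φ.source ∧ φ x.proj = 0 ∧
      ∀ y ∈ e.source, y.proj ∈ φ.source ∧
        φ y.proj = e y ^ RootSpace.ramification p (branchFun c) x.proj := by
  obtain ⟨φ, hφ, ψ, hψ, hx, hx0, hg⟩ := exists_coord_branchFun_factor hc x.proj
  obtain ⟨e, he, he0, h⟩ := RootSpace.exists_chart hp hcop x ψ hx hx0 hg
  rcases hψ with rfl | rfl
  · exact ⟨ψ, hφ, e, he, he0, hx, hx0, h⟩
  · -- the conjugate of `e` is a chart in which the projection is a power map for `φ` itself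
    refine ⟨φ, hφ, e.transHomeomorph conjHomeomorph, by simpa using he, by simp [he0],
      by simpa using hx, by simpa using hx0, fun y hy => ?_⟩
    obtain ⟨h1, h2⟩ := h y (by simpa using hy)
    refine ⟨by simpa using h1, ?_⟩
    have h3 : conj (φ y.proj) = e y ^ RootSpace.ramification p (branchFun c) x.proj := h2
    have h4 := congrArg conj h3
    rw [Complex.conj_conj, map_pow] at h4
    exact h4

theorem isOrientableSurface_rootSpace (hc : Function.Injective c) (hp : ∀ i, p i ≠ 0)
    (hcop : Pairwise fun i j => (p i).Coprime (p j)) :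
    IsOrientableSurface (RootSpace p (branchFun c)) := by
  refine isOrientableSurface_of_powerChart (π := RootSpace.proj) differentiableOn_coordChange
    fun x => ?_
  obtain ⟨φ, hφ, e, he, -, -, -, h⟩ := exists_chart_branchFun hc hp hcop x
  exact ⟨e, ⟨φ, hφ, _, Finset.prod_ne_zero_iff.2 fun i _ => hp i, h⟩, he⟩

theorem isClosedOrientableSurface_rootSpace [Nontrivial ι] (hc : Function.Injective c)
    (hp : ∀ i, p i ≠ 0) (hcop : Pairwise fun i j => (p i).Coprime (p j)) :
    IsClosedOrientableSurface (RootSpace p (branchFun c)) := by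
  have hor := isOrientableSurface_rootSpace hc hp hcop
  have hcomp : CompactSpace (RootSpace p (branchFun c)) :=
    RootSpace.compactSpace hp (continuous_branchFun c)
  refine ⟨hor, hcomp, ?_⟩
  have hloc : LocallyConnectedSpace (RootSpace p (branchFun c)) := by
    obtain ⟨-, cs, -⟩ := hor
    exact ChartedSpace.locallyConnectedSpace (EuclideanSpace ℝ (Fin 2)) _
  obtain ⟨i, j, hij⟩ := exists_pair_ne ι
  have hfix : ∀ (j : ι) (x : RootSpace p (branchFun c)), x.proj = c (j, 0) →
      ∀ k : ℤ, (p j : ℤ) ∣ k → (RootSpace.rotation p (branchFun c) ^ k) x = x := by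
    intro j x hx k hk
    rw [RootSpace.rotation_zpow_apply_eq_self_iff hp hcop, hx, fibreCard_branch hc]
    exact hk
  have : PreconnectedSpace (RootSpace p (branchFun c)) :=
    preconnectedSpace_of_orbit_fibres RootSpace.continuous_proj (RootSpace.surjective_proj hp)
      (RootSpace.proj_eq_iff_mem_mapOrbit hp hcop) (hcop hij).isCoprime (hfix i) (hfix j)
  obtain ⟨x, -⟩ := RootSpace.surjective_proj (g := branchFun c) hp infty
  exact { toNonempty := ⟨x⟩ }

theorem isCyclicBranchedCover_rootSpace (hc : Function.Injective c) (hp : ∀ i, p i ≠ 0)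
    (hcop : Pairwise fun i j => (p i).Coprime (p j)) {S : Type} [TopologicalSpace S]
    (H : OnePoint ℂ ≃ₜ S) :
    IsCyclicBranchedCover (RootSpace.rotation p (branchFun c)) (H ∘ RootSpace.proj) where
  continuous := H.continuous.comp RootSpace.continuous_proj
  surjective := H.surjective.comp (RootSpace.surjective_proj hp)
  fibre x y := by
    rw [← RootSpace.proj_eq_iff_mem_mapOrbit hp hcop]
    exact H.injective.eq_iff
  powerMapAt x := by
    obtain ⟨φ, -, e, he, he0, hx, hx0, h⟩ := exists_chart_branchFun hc hp hcop x
    rw [RootSpace.isotropyOrder_rotation hp hcop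
      (branchFun_ne_zero_of_notMem infty_notMem_range_branch)]
    refine ⟨e, H.symm.transOpenPartialHomeomorph φ, he, he0, ?_, ?_, fun y hy => ?_⟩
    · simpa using hx
    · simpa using hx0
    · simpa using h y hy

end Branched

end RiemannSphere

/-! ### Existence of the surface and the map -/

theorem pairwise_coprime_nth_prime (l : ℕ) :
    Pairwise fun i j : Fin l => (Nat.nth Nat.Prime i).Coprime (Nat.nth Nat.Prime j) := by
  intro i j hij
  rw [Nat.coprime_primes (Nat.prime_nth_prime _) (Nat.prime_nth_prime _)]
  intro h
  exact hij (Fin.ext (Nat.nth_injective Nat.infinite_setOfPred_prime h))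

/-- The positions of the cone points in the affine coordinate, distinct Gaussian integers. -/
noncomputable def conePoint {l : ℕ} (js : Fin l × Fin 2) : ℂ := ⟨(js.1 : ℕ), (js.2 : ℕ)⟩

theorem injective_conePoint {l : ℕ} : Function.Injective (conePoint (l := l)) := by
  rintro ⟨i, s⟩ ⟨j, t⟩ h
  have h1 := congrArg Complex.re h
  have h2 := congrArg Complex.im h
  simp only [conePoint, Nat.cast_inj] at h1 h2
  exact Prod.ext (Fin.ext h1) (Fin.ext h2)

/-- The Riemann sphere as the unit sphere of `ℝ³`. -/
noncomputable def riemannSphereHomeomorph :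
    OnePoint ℂ ≃ₜ Metric.sphere (0 : EuclideanSpace ℝ (Fin 3)) 1 :=
  onePointEquivSphereOfFinrankEq (ι := Fin 3) (by simp)

theorem proposition4p1 (l : ℕ) (hl : 0 < l) :
    ∃ (F : Type) (_ : TopologicalSpace F) (f : F ≃ₜ F),
      IsClosedOrientableSurface F ∧
      -- `f` is periodic, of order the product of the first `l` primes
      orderOf f = primeProd l ∧
      -- `l` points whose orbit lengths are the first `l` primes; in particular these lengths
      -- are greater than one and pairwise coprime
      (∃ x : Fin l → F,
        (∀ j, orbitLength f (x j) = Nat.nth Nat.Prime j) ∧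
        (∀ j, 1 < orbitLength f (x j)) ∧
        (∀ i j, i ≠ j → Nat.Coprime (orbitLength f (x i)) (orbitLength f (x j)))) ∧
      -- for `l ≥ 2`, the surface is a cyclic branched cover of the two-sphere with exactly `2 * l`
      -- cone points, two of order `P_l / p_j` for each `j`
      (2 ≤ l →
        ∃ (π : F → Metric.sphere (0 : EuclideanSpace ℝ (Fin 3)) 1)
          (c : Fin l × Fin 2 → Metric.sphere (0 : EuclideanSpace ℝ (Fin 3)) 1),
          IsCyclicBranchedCover f π ∧ Function.Injective c ∧
          (∀ x j s, π x = c (j, s) →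
            isotropyOrder f x = primeProd l / Nat.nth Nat.Prime j ∧
            orbitLength f x = Nat.nth Nat.Prime j) ∧
          (∀ x, π x ∉ Set.range c → isotropyOrder f x = 1 ∧ orbitLength f x = primeProd l)) := by
  -- it is enough to find points with the given orbit lengths
  have hpts : ∀ (F : Type) [TopologicalSpace F] (f : F ≃ₜ F) (x : Fin l → F),
      (∀ j, orbitLength f (x j) = Nat.nth Nat.Prime j) →
      (∀ j, orbitLength f (x j) = Nat.nth Nat.Prime j) ∧ (∀ j, 1 < orbitLength f (x j)) ∧
        (∀ i j, i ≠ j → Nat.Coprime (orbitLength f (x i)) (orbitLength f (x j))) := by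
    intro F _ f x h
    refine ⟨h, fun j => ?_, fun i j hij => ?_⟩
    · rw [h]
      exact (Nat.prime_nth_prime _).one_lt
    · rw [h, h]
      exact pairwise_coprime_nth_prime l hij
  have hp : ∀ (m : ℕ) (i : Fin m), Nat.nth Nat.Prime i ≠ 0 := fun m i =>
    (Nat.prime_nth_prime _).ne_zero
  have hb : ∀ (m : ℕ) (i : Fin m), RiemannSphere.branchFun conePoint i OnePoint.infty ≠ 0 :=
    fun m => RiemannSphere.branchFun_ne_zero_of_notMem RiemannSphere.infty_notMem_range_branch
  rcases Nat.lt_or_ge l 2 with h2 | h2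
  · -- for one prime, the surface for two primes with the cube of its map of order `6`
    obtain rfl : l = 1 := by omega
    let p : Fin 2 → ℕ := fun i => Nat.nth Nat.Prime i
    let f := RootSpace.rotation p (RiemannSphere.branchFun conePoint)
    obtain ⟨x, hx⟩ := RootSpace.surjective_proj (g := RiemannSphere.branchFun conePoint)
      (hp 2) (conePoint ((0 : Fin 2), 0))
    have hf : orderOf f = 6 := by
      rw [RootSpace.orderOf_rotation (hp 2) (pairwise_coprime_nth_prime 2) (hb 2)]
      simp [Fin.prod_univ_two, Nat.nth_prime_zero_eq_two, Nat.nth_prime_one_eq_three]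
    have hper : ∀ k : ℤ, ((f ^ 3) ^ k) x = x ↔ ((2 : ℕ) : ℤ) ∣ k := by
      intro k
      have h3 : (f ^ 3) ^ k = f ^ (3 * k) := by
        rw [zpow_mul]
        rfl
      have h4 : p 0 = 2 := Nat.nth_prime_zero_eq_two
      rw [h3, RootSpace.rotation_zpow_apply_eq_self_iff (hp 2) (pairwise_coprime_nth_prime 2), hx,
        RiemannSphere.fibreCard_branch injective_conePoint]
      change ((p 0 : ℕ) : ℤ) ∣ 3 * k ↔ _
      rw [h4]
      omega
    refine ⟨RootSpace p (RiemannSphere.branchFun conePoint), inferInstance, f ^ 3,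
      RiemannSphere.isClosedOrientableSurface_rootSpace injective_conePoint (hp 2)
        (pairwise_coprime_nth_prime 2), ?_, ⟨fun _ => x, hpts _ _ _ fun j => ?_⟩, fun h => by omega⟩
    · rw [orderOf_pow' _ three_ne_zero, hf]
      simp [primeProd, Nat.nth_prime_zero_eq_two]
    · rw [orbitLength_eq_of_period two_ne_zero hper, Subsingleton.elim j 0]
      exact Nat.nth_prime_zero_eq_two.symm
  · have : Nontrivial (Fin l) := Fin.nontrivial_iff_two_le.2 h2
    let p : Fin l → ℕ := fun i => Nat.nth Nat.Prime i
    have hcop : Pairwise fun i j => (p i).Coprime (p j) := pairwise_coprime_nth_prime l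
    let f := RootSpace.rotation p (RiemannSphere.branchFun conePoint)
    have hlen : ∀ y j s, RootSpace.proj y = (conePoint (j, s) : OnePoint ℂ) →
        orbitLength f y = p j := fun y j s hy => by
      rw [RootSpace.orbitLength_rotation (hp l) hcop, hy,
        RiemannSphere.fibreCard_branch injective_conePoint]
    choose x hx using fun j : Fin l => RootSpace.surjective_proj (p := p)
      (g := RiemannSphere.branchFun conePoint) (hp l) (conePoint (j, 0))
    refine ⟨RootSpace p (RiemannSphere.branchFun conePoint), inferInstance, f,
      RiemannSphere.isClosedOrientableSurface_rootSpace injective_conePoint (hp l) hcop,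
      RootSpace.orderOf_rotation (hp l) hcop (hb l),
      ⟨x, hpts _ _ _ fun j => hlen _ _ _ (hx j)⟩, fun _ => ?_⟩
    refine ⟨riemannSphereHomeomorph ∘ RootSpace.proj,
      fun js => riemannSphereHomeomorph (conePoint js),
      RiemannSphere.isCyclicBranchedCover_rootSpace injective_conePoint (hp l) hcop _,
      fun a b hab => injective_conePoint
        (OnePoint.coe_injective (riemannSphereHomeomorph.injective hab)), ?_, ?_⟩
    · intro y j s hy
      have hy' : y.proj = (conePoint (j, s) : OnePoint ℂ) := riemannSphereHomeomorph.injective hy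
      refine ⟨?_, hlen y j s hy'⟩
      have h3 := RootSpace.ramification_mul_fibreCard (p := p)
        (g := RiemannSphere.branchFun conePoint) y.proj
      rw [hy', RiemannSphere.fibreCard_branch injective_conePoint] at h3
      rw [RootSpace.isotropyOrder_rotation (hp l) hcop (hb l), hy']
      exact (Nat.div_eq_of_eq_mul_left (Nat.pos_of_ne_zero (hp l j)) h3.symm).symm
    · intro y hy
      have hy' : y.proj ∉ range fun js : Fin l × Fin 2 => (conePoint js : OnePoint ℂ) := by
        rintro ⟨js, h⟩
        exact hy ⟨js, congrArg riemannSphereHomeomorph h⟩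
      rw [RootSpace.isotropyOrder_rotation (hp l) hcop (hb l),
        RootSpace.orbitLength_rotation (hp l) hcop,
        RiemannSphere.fibreCard_of_notMem hy', RootSpace.ramification,
        Finset.filter_false_of_mem fun i _ => RiemannSphere.branchFun_ne_zero_of_notMem hy' i]
      exact ⟨Finset.prod_empty, rfl⟩
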